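/- Let $k$ be an algebraically closed field of characteristic $0$, let $s\ge 1$, and let $\mathbb P^{s-1}=\operatorname{Proj}k[Y_1,\dots,Y_s]$, with structure sheaf $\mathcal O$. A sheaf of $\mathcal O$-supermodules is a $\mathbb Z/2$-graded sheaf of $\mathcal O$-modules $\mathscr F=\mathscr F_{ev}\oplus\mathscr F_{od}$, where $\mathcal O$ is regarded as purely even; it is coherent if its underlying $\mathcal O$-module is. It is a super vector bundle of rank $(m|n)$, with $m,n\ge 0$, if every point has an open neighbourhood on which it is free with a basis of $m$ even and $n$ odd sections. An odd map $f:\mathscr F\to\mathscr F'$ is an $\mathcal O$-linear map with $f(\mathscr F_{ev})\subseteq\mathscr F'_{od}$ and $f(\mathscr F_{od})\subseteq\mathscr F'_{ev}$; its cokernel and its image carry the grading induced from $\mathscr F'$. The fibre of $\mathscr F$ at a (scheme) point $x$ is the $\mathbb Z/2$-graded $k(x)$-vector space $\mathscr F(x)=\mathscr F_x\otimes_{\mathcal O_x}k(x)$. The map induced by an odd map $f$ on fibres at $x$ is denoted $f(x):\mathscr F(x)\to\mathscr F'(x)$; it has rank $(a|b)$ if its restrictions $\mathscr F(x)_{ev}\to\mathscr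 F'(x)_{od}$ and $\mathscr F(x)_{od}\to\mathscr F'(x)_{ev}$ have rank $a$ and $b$ respectively. **Theorem.** 1. Let $\mathscr F$ be a coherent sheaf of $\mathcal O$-supermodules on $\mathbb P^{s-1}$ and let $r_{ev},r_{od}\ge 0$. Then $\mathscr F$ is a super vector bundle of rank $(r_{ev}|r_{od})$ if and only if $\dim_{k(x)}\mathscr F(x)_{ev}=r_{ev}$ and $\dim_{k(x)}\mathscr F(x)_{od}=r_{od}$ for all $x\in\mathbb P^{s-1}$. 2. Let $f:\mathscr F\to\mathscr F'$ be an odd map of super vector bundles on $\mathbb P^{s-1}$, where $\mathscr F'$ has rank $(r_{ev}|r_{od})$. For all integers $r'_{ev},r'_{od}\ge 0$ the following are equivalent: (a) $r'_{od}\le r_{ev}$, $r'_{ev}\le r_{od}$, and the cokernel of $f$ is a super vector bundle of rank $(r_{ev}-r'_{od}\,|\,r_{od}-r'_{ev})$; (b) $f(x)$ has rank $(r'_{ev}|r'_{od})$ for all $x\in\mathbb P^{s-1}$. If these hold, then the image of $f$ is a super vector bundle of rank $(r'_{od}|r'_{ev})$; equivalently, $\mathscr F/\operatorname{Ker}f$,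 which is the image of $f$ with the grading transported from $\mathscr F$, is a super vector bundle of rank $(r'_{ev}|r'_{od})$. In particular, the cokernel of $f$ is a super vector bundle of some rank if and only if the rank of $f(x)$ is the same for all $x\in\mathbb P^{s-1}$. -/

import Mathlib

open CategoryTheory AlgebraicGeometry TopologicalSpace TensorProduct

universe u

noncomputable section

namespace SuperGeometry

variable {X : Scheme.{u}}

/-! ### Stalks, fibres and free sections of `𝒪_X`-modules -/

/-- The stalk `M_x` of an `𝒪_X`-module is a module over the local ring `𝒪_{X,x}`. -/
instance stalkModule (M : X.Modules) (x : X) :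
    Module (X.presheaf.stalk x) (M.presheaf.stalk x) :=
  PresheafOfModules.instModuleCarrierStalkCommRingCatCarrierAbPresheafOpensCarrier
    (R := X.presheaf) M.val x

theorem germ_smul (M : X.Modules) (x : X) (U : X.Opens) (hx : x ∈ U)
    (r : Γ(X, U)) (m : Γ(M, U)) :
    M.presheaf.germ U x hx (r • m) =
      X.presheaf.germ U x hx r • M.presheaf.germ U x hx m :=
  PresheafOfModules.germ_smul (R := X.presheaf) M.val x U hx r m

/-- The `𝒪_{X,x}`-linear map `M_x → N_x` induced by a morphism of `𝒪_X`-modules. -/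
def stalkMap {M N : X.Modules} (φ : M ⟶ N) (x : X) :
    M.presheaf.stalk x →ₗ[X.presheaf.stalk x] N.presheaf.stalk x where
  toFun := (TopCat.Presheaf.stalkFunctor Ab x).map φ.mapPresheaf
  map_add' := map_add _
  map_smul' r m := by
    obtain ⟨U, hU, r, rfl⟩ := X.presheaf.exists_germ_eq r
    obtain ⟨V, hV, m, rfl⟩ := M.presheaf.exists_germ_eq m
    have hx : x ∈ U ⊓ V := ⟨hU, hV⟩
    have hr := X.presheaf.germ_res_apply (homOfLE (inf_le_left : U ⊓ V ≤ U)) x hx r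
    have hm := M.presheaf.germ_res_apply (homOfLE (inf_le_right : U ⊓ V ≤ V)) x hx m
    rw [← hr, ← hm, ← germ_smul, TopCat.Presheaf.stalkFunctor_map_germ_apply]
    erw [TopCat.Presheaf.stalkFunctor_map_germ_apply]
    rw [RingHom.id_apply, ← germ_smul]
    exact congrArg _ (Scheme.Modules.Hom.app_smul φ _ _)

/-- The residue field `κ(x)` is an algebra over `𝒪_{X,x}` through the quotient map. -/
instance residueFieldAlgebra (x : X) : Algebra (X.presheaf.stalk x) (X.residueField x) :=
  (X.residue x).hom.toAlgebra

/-- The fibre `κ(x) ⊗ M_x` (over `𝒪_{X,x}`) of an `𝒪_X`-module, a `κ(x)`-vector space. -/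
abbrev Fibre (M : X.Modules) (x : X) : Type u :=
  X.residueField x ⊗[X.presheaf.stalk x] M.presheaf.stalk x

/-- The `κ(x)`-linear map induced on fibres by a morphism of `𝒪_X`-modules. -/
def fibreMap {M N : X.Modules} (φ : M ⟶ N) (x : X) :
    Fibre M x →ₗ[X.residueField x] Fibre N x :=
  (stalkMap φ x).baseChange (X.residueField x)

/-- The sections `e i` of `M` over `U` form a basis of the `𝒪_U`-module `M|_U`: over every open
`V ⊆ U` their restrictions form a basis of the `𝒪_X(V)`-module `M(V)`. -/
def IsBasisOn (M : X.Modules) (U : X.Opens) {ι : Type} (e : ι → Γ(M, U)) : Prop :=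
  ∀ (V : X.Opens) (h : V ≤ U),
    LinearIndependent Γ(X, V)
      (fun i => (M.presheaf.map (homOfLE h).op (e i) : Γ(M, V))) ∧
    Submodule.span Γ(X, V)
      (Set.range fun i => (M.presheaf.map (homOfLE h).op (e i) : Γ(M, V))) = ⊤

/-! ### Sheaves of `𝒪_X`-supermodules -/

variable (X) in
/-- A sheaf of `𝒪_X`-supermodules, i.e. of `ℤ/2`-graded `𝒪_X`-modules, where `𝒪_X` is purely even:
it is given by its even and its odd homogeneous part. -/
structure SuperModules where
  even : X.Modules
  odd : X.Modules

namespace SuperModules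

variable (F : SuperModules X)

/-- The underlying ungraded `𝒪_X`-module: the direct sum of the even and the odd part. -/
def total : X.Modules := Limits.biprod F.even F.odd

/-- Coherence of the underlying `𝒪_X`-module, in the form that is usual on a (locally) Noetherian
scheme: quasi-coherent and of finite type. -/
def IsCoherent : Prop :=
  F.total.IsQuasicoherent ∧ F.total.IsFiniteType

/-- `F` is a super vector bundle of rank `(m|n)`: locally it is free with a homogeneous basis
of `m` even and `n` odd sections. -/
def IsSuperVectorBundle (m n : ℕ) : Prop :=
  ∀ x : X, ∃ (U : X.Opens) (_ : x ∈ U) (e : Fin m → Γ(F.even, U)) (o : Fin n → Γ(F.odd, U)),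
    IsBasisOn F.even U e ∧ IsBasisOn F.odd U o

/-- The pair (even dimension, odd dimension) of the fibre of `F` at `x`, over `κ(x)`. -/
def fibreDim (x : X) : ℕ × ℕ :=
  (Module.finrank (X.residueField x) (Fibre F.even x),
    Module.finrank (X.residueField x) (Fibre F.odd x))

end SuperModules

/-- An odd morphism of sheaves of supermodules: an `𝒪_X`-linear map that exchanges parities. -/
structure OddHom (F G : SuperModules X) where
  evenToOdd : F.even ⟶ G.odd
  oddToEven : F.odd ⟶ G.even

namespace OddHom

variable {F G : SuperModules X} (f : OddHom F G)

/-- The cokernel of `f`, with the grading that it has as a quotient of the target. -/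
def coker : SuperModules X where
  even := Limits.cokernel f.oddToEven
  odd := Limits.cokernel f.evenToOdd

/-- The image of `f`, with the grading that it has as a subsheaf of the target. -/
def image : SuperModules X where
  even := Abelian.image f.oddToEven
  odd := Abelian.image f.evenToOdd

/-- The quotient of the source by the kernel of `f`, with the grading that it has as a quotient
of the source. -/
def coimage : SuperModules X where
  even := Abelian.coimage f.evenToOdd
  odd := Abelian.coimage f.oddToEven

/-- The rank at `x` of the odd map that `f` induces on fibres: first the rank of its restriction
to the even part of the fibre of the source, then of its restriction to the odd part. -/
def fibreRank (x : X) : ℕ × ℕ :=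
  (Module.finrank (X.residueField x) (LinearMap.range (fibreMap f.evenToOdd x)),
    Module.finrank (X.residueField x) (LinearMap.range (fibreMap f.oddToEven x)))

end OddHom

/-- The projective space `ℙ^{s-1}` over `k`, as the scheme `Proj k[Y_1, …, Y_s]`. -/
def ProjectiveSpace (k : Type u) [Field k] (s : ℕ) : Scheme.{u} :=
  letI := MvPolynomial.gradedAlgebra (σ := Fin s) (R := k)
  Proj (MvPolynomial.homogeneousSubmodule (Fin s) k)

end SuperGeometry

end

noncomputable section

/-! ### Local images and local generators of sheaves of modules on a site. -/

namespace SheafOfModules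

universe v' u'

variable {C : Type u'} [Category.{v'} C] {J : GrothendieckTopology C} {R : Sheaf J RingCat.{u}}

/-! Parity only pairs two ungraded statements, so it suffices to treat ordinary modules on a reduced
nonempty scheme.

Suppose `M` is locally generated by finitely many sections and all its fibres have dimension `n`. By
Nakayama a basis of one fibre lifts to `n` generators of the stalk, and these generate all stalks
nearby. By counting, they form a basis of every nearby fibre, so the coefficients of a relation
vanish in all residue fields; on a reduced scheme they are zero. This is
`isVectorBundle_of_finrank_fibre`.

For `f : M ⟶ N`, right exactness of the fibre functor gives `dim coker(f)(x) = dim N(x) - rank f(x)`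
(`finrank_fibre_cokernel`), so constant rank is equivalent to a locally free cokernel. In that case
the image splits off from `N` on stalks, its fibre at `x` is the range of `f(x)`
(`finrank_fibre_image`), and the criterion applies again. The coimage is isomorphic to the image.

The fibre computations rest on exactness of stalks, obtained by testing sections against the
sheafified presheaf cokernel. -/

lemma presheaf_mem_range_of_cokernel_π_eq_zero {M N : PresheafOfModules.{u} R.obj} (f : M ⟶ N)
    {X : Cᵒᵖ} (t : N.obj X) (h : (Limits.cokernel.π f).app X t = 0) :
    ∃ s, f.app X s = t := by
  have h1 := ((ShortComplex.mk f (Limits.cokernel.π f)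
    (Limits.cokernel.condition f)).exact_of_g_is_cokernel (Limits.cokernelIsCokernel f)).map
      (PresheafOfModules.evaluation R.obj X)
  exact (ShortComplex.moduleCat_exact_iff _).1 h1 t h

/-- If every morphism out of `N` that kills the image of `f` kills the section `t` of `N`, then `t`
lies locally in the image of `f`. -/
lemma imageSieve_mem_of_forall_comp_eq_zero
    [HasWeakSheafify J AddCommGrpCat.{u}] [J.WEqualsLocallyBijective AddCommGrpCat.{u}]
    {M N : SheafOfModules.{u} R} (f : M ⟶ N) {X : C} (t : N.val.obj (.op X))
    (h : ∀ (Q : SheafOfModules.{u} R) (g : N ⟶ Q), f ≫ g = 0 → g.val.app (.op X) t = 0) :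
    Presheaf.imageSieve ((PresheafOfModules.toPresheaf R.obj).map f.val) t ∈ J X := by
  let q := Limits.cokernel.π f.val
  let adj := PresheafOfModules.sheafificationAdjunction (J := J) (𝟙 R.obj)
  let η := adj.unit.app (Limits.cokernel f.val)
  -- The universal test morphism: a section that it kills vanishes locally already in the presheaf
  -- cokernel.
  let g : N ⟶ (PresheafOfModules.sheafification (𝟙 R.obj)).obj (Limits.cokernel f.val) :=
    ⟨q ≫ η⟩
  have hg : f ≫ g = 0 := by
    ext1
    exact (Limits.cokernel.condition_assoc f.val η).trans Limits.zero_comp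
  have h0 : (CategoryTheory.toSheafify J (Limits.cokernel f.val).presheaf).app (.op X)
      (q.app (.op X) t) = 0 := h _ g hg
  have h1 := Presheaf.equalizerSieve_mem J
    (CategoryTheory.toSheafify J (Limits.cokernel f.val).presheaf) (q.app (.op X) t) 0
    (by rw [h0, map_zero])
  refine J.superset_covering ?_ h1
  intro Y i hi
  have h2 : (Limits.cokernel f.val).presheaf.map i.op (q.app (.op X) t) = 0 :=
    hi.trans (map_zero _)
  apply presheaf_mem_range_of_cokernel_π_eq_zero
  exact (PresheafOfModules.naturality_apply q i.op t).trans h2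

lemma sum_val_app {M N : SheafOfModules.{u} R} {I : Type*} (s : Finset I) (f : I → (M ⟶ N))
    (X : Cᵒᵖ) (t : M.val.obj X) :
    (∑ i ∈ s, f i).val.app X t = ∑ i ∈ s, (f i).val.app X t := by
  classical
  induction s using Finset.induction_on with
  | empty => rfl
  | insert a s ha ih =>
    rw [Finset.sum_insert ha, Finset.sum_insert ha, ← ih]
    rfl

variable [HasWeakSheafify J AddCommGrpCat.{u}] [J.WEqualsLocallyBijective AddCommGrpCat.{u}]

/-- The sections of a finite free sheaf of modules are combinations of the tautological ones. -/
lemma exists_eq_sum_smul_freeSection {I : Type u} [Fintype I] {X : Cᵒᵖ}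
    (t : (free (R := R) I).val.obj X) :
    ∃ a : I → R.obj.obj X, t = ∑ i, a i • (freeSection (R := R) i).eval X := by
  classical
  let p (i : I) : free (R := R) I ⟶ unit R :=
    Limits.Cofan.IsColimit.desc (isColimitFreeCofan I) (fun j ↦ if j = i then 𝟙 _ else 0)
  have hp (i j : I) : ιFree j ≫ p i = if j = i then 𝟙 _ else 0 :=
    Limits.Cofan.IsColimit.fac (isColimitFreeCofan I) _ j
  -- A finite coproduct is a biproduct, so the coordinates of `t` are its images under the
  -- projections `p i`.
  have hid : ∑ i, p i ≫ ιFree i = 𝟙 (free (R := R) I) := by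
    refine Limits.Cofan.IsColimit.hom_ext (isColimitFreeCofan I) _ _ fun j ↦ ?_
    change ιFree j ≫ _ = ιFree j ≫ _
    rw [Preadditive.comp_sum, Category.comp_id, Finset.sum_eq_single j]
    · rw [← Category.assoc, hp, if_pos rfl, Category.id_comp]
    · intro i _ hi
      rw [← Category.assoc, hp, if_neg hi.symm, Limits.zero_comp]
    · simp
  refine ⟨fun i ↦ (p i).val.app X t, ?_⟩
  have h : t = (∑ i, p i ≫ ιFree i).val.app X t := by rw [hid]; rfl
  rw [sum_val_app] at h
  refine h.trans (Finset.sum_congr rfl fun i _ ↦ ?_)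
  let b : R.obj.obj X := (p i).val.app X t
  have h2 := ((ιFree (R := R) i).val.app X).hom.map_smul b (1 : R.obj.obj X)
  exact (congrArg ((ιFree (R := R) i).val.app X) (mul_one b).symm).trans h2

/-- Sections that generate a sheaf of modules generate it locally in the naive sense. -/
lemma GeneratingSections.exists_sieve {M : SheafOfModules.{u} R} (G : M.GeneratingSections)
    [G.IsFiniteType] {X : C} (t : M.val.obj (.op X)) :
    ∃ S ∈ J X, ∀ ⦃Y : C⦄ (i : Y ⟶ X), S i →
      M.val.restrictₛₗ i.op t ∈ Submodule.span (R.obj.obj (.op Y))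
        (Set.range fun j ↦ ((G.s j).eval (.op Y) : M.val.obj (.op Y))) := by
  refine ⟨_, imageSieve_mem_of_forall_comp_eq_zero G.π t ?_, ?_⟩
  · intro Q g hg
    obtain rfl : g = 0 := by
      rw [← cancel_epi G.π, hg, Limits.comp_zero]
    rfl
  · rintro Y i ⟨s, hs⟩
    have : Fintype G.I := Fintype.ofFinite _
    obtain ⟨a, ha⟩ := exists_eq_sum_smul_freeSection s
    have hs' : M.val.restrictₛₗ i.op t = G.π.val.app (.op Y) s := hs.symm
    rw [hs', ha, map_sum]
    refine Submodule.sum_mem _ fun j _ ↦ ?_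
    rw [map_smul]
    refine Submodule.smul_mem _ _ (Submodule.subset_span ⟨j, ?_⟩)
    exact congrArg (fun σ : M.sections ↦ σ.eval (.op Y))
      (sectionsMap_freeHomEquiv_symm_freeSection G.s j).symm

/-- A sheaf of modules of finite type is locally generated by finitely many sections, in the naive
sense. -/
lemma IsFiniteType.exists_sieve
    {C : Type u'} [Category.{v'} C] {J : GrothendieckTopology C} {R : Sheaf J RingCat.{u}}
    [∀ X : C, HasWeakSheafify (J.over X) AddCommGrpCat.{u}]
    [∀ X : C, (J.over X).WEqualsLocallyBijective AddCommGrpCat.{u}]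
    (M : SheafOfModules.{u} R) [h : M.IsFiniteType] (X : C) :
    ∃ S ∈ J X, ∀ ⦃Y : C⦄ (i : Y ⟶ X), S i → ∃ (n : ℕ) (e : Fin n → M.val.obj (.op Y)),
      ∀ ⦃Z : C⦄ (j : Z ⟶ Y) (t : M.val.obj (.op Z)), ∃ T ∈ J Z, ∀ ⦃W : C⦄ (l : W ⟶ Z), T l →
        M.val.restrictₛₗ l.op t ∈ Submodule.span (R.obj.obj (.op W))
          (Set.range fun a ↦ M.val.restrictₛₗ (l ≫ j).op (e a)) := by
  obtain ⟨σ, hσ⟩ := h.exists_localGeneratorsData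
  refine ⟨_, σ.coversTop X, ?_⟩
  rintro Y i ⟨b, ⟨k⟩⟩
  have := hσ.isFiniteType b
  have : Fintype (σ.generators b).I := Fintype.ofFinite _
  let ε := Fintype.equivFin (σ.generators b).I
  refine ⟨_, fun a ↦ ((σ.generators b).s (ε.symm a)).eval (.op (Over.mk k)), fun Z j t ↦ ?_⟩
  obtain ⟨S, hS, h⟩ := (σ.generators b).exists_sieve (X := Over.mk (j ≫ k)) t
  refine ⟨_, (GrothendieckTopology.mem_over_iff _ _).1 hS, fun W l hl ↦ ?_⟩
  rw [Sieve.overEquiv_iff] at hl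
  have key : M.val.restrictₛₗ l.op t ∈ Submodule.span (R.obj.obj (.op W))
      (Set.range fun c ↦ (show M.val.obj (.op W) from
        ((σ.generators b).s c).eval (.op (Over.mk (l ≫ j ≫ k))))) := h _ hl
  refine Submodule.span_mono ?_ key
  rintro _ ⟨c, rfl⟩
  -- Global sections over the slice are compatible families, so evaluating at the composite agrees
  -- with restricting along `l ≫ j`.
  let f : Over.mk (l ≫ j ≫ k) ⟶ Over.mk k := Over.homMk (l ≫ j)
  have hf := PresheafOfModules.sections_property ((σ.generators b).s c) f.op
  refine ⟨ε c, ?_⟩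
  dsimp only
  rw [ε.symm_apply_apply]
  exact hf

end SheafOfModules

namespace SuperGeometry

variable {X : Scheme.{u}} {M N P : X.Modules}

/-! ### Exactness of the stalk functors -/

@[simp]
lemma stalkMap_germ (φ : M ⟶ N) (x : X) (U : X.Opens) (hx : x ∈ U) (t : Γ(M, U)) :
    stalkMap φ x (M.presheaf.germ U x hx t) = N.presheaf.germ U x hx (φ.app U t) :=
  TopCat.Presheaf.stalkFunctor_map_germ_apply U x hx φ.mapPresheaf t

lemma stalkMap_comp_apply (φ : M ⟶ N) (ψ : N ⟶ P) (x : X) (m : M.presheaf.stalk x) :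
    stalkMap (φ ≫ ψ) x m = stalkMap ψ x (stalkMap φ x m) := by
  obtain ⟨U, hU, m, rfl⟩ := M.presheaf.exists_germ_eq m
  simp

lemma stalkMap_zero (x : X) : stalkMap (0 : M ⟶ N) x = 0 := by
  ext m
  obtain ⟨U, hU, m, rfl⟩ := M.presheaf.exists_germ_eq m
  simp

lemma germ_mem_range_of_forall_comp_eq_zero (f : M ⟶ N) {U : X.Opens} (t : Γ(N, U))
    (h : ∀ (Q : X.Modules) (g : N ⟶ Q), f ≫ g = 0 → g.app U t = 0) (x : X) (hx : x ∈ U) :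
    N.presheaf.germ U x hx t ∈ LinearMap.range (stalkMap f x) := by
  obtain ⟨V, i, ⟨s, hs⟩, hV⟩ :=
    SheafOfModules.imageSieve_mem_of_forall_comp_eq_zero (R := X.ringCatSheaf) f t h x hx
  have hs' : f.app V s = N.presheaf.map i.op t := hs
  refine ⟨M.presheaf.germ V x hV s, (stalkMap_germ f x V hV s).trans ?_⟩
  rw [hs', TopCat.Presheaf.germ_res_apply]

lemma stalkMap_surjective (f : M ⟶ N) [Epi f] (x : X) : Function.Surjective (stalkMap f x) := by
  intro n
  obtain ⟨U, hU, n, rfl⟩ := N.presheaf.exists_germ_eq n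
  refine germ_mem_range_of_forall_comp_eq_zero f n (fun Q g hg ↦ ?_) x hU
  obtain rfl : g = 0 := by rw [← cancel_epi f, hg, Limits.comp_zero]
  rfl

/-- If the class of a germ in the cokernel vanishes, it vanishes on a neighbourhood; there every
morphism killing `f` kills the section, since it factors through the cokernel. -/
lemma stalkMap_exact (f : M ⟶ N) (x : X) :
    Function.Exact (stalkMap f x) (stalkMap (Limits.cokernel.π f) x) := by
  intro n
  constructor
  · intro hn
    obtain ⟨U, hU, n, rfl⟩ := N.presheaf.exists_germ_eq n
    rw [stalkMap_germ] at hn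
    obtain ⟨V, hV, i, j, h⟩ := TopCat.Presheaf.germ_eq _ x hU hU
      ((Limits.cokernel.π f).app U n) 0 (hn.trans (map_zero _).symm)
    rw [map_zero] at h
    have hn' : (Limits.cokernel.π f).app V (N.presheaf.map i.op n) = 0 :=
      (NatTrans.naturality_apply (Limits.cokernel.π f).mapPresheaf i.op n).trans h
    have := germ_mem_range_of_forall_comp_eq_zero f (N.presheaf.map i.op n)
      (fun Q g hg ↦ ?_) x hV
    · rwa [TopCat.Presheaf.germ_res_apply] at this
    · rw [← Limits.cokernel.π_desc f g hg, Scheme.Modules.Hom.comp_app, ConcreteCategory.comp_apply,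
        hn', map_zero]
  · rintro ⟨m, rfl⟩
    rw [← stalkMap_comp_apply, Limits.cokernel.condition, stalkMap_zero, LinearMap.zero_apply]

lemma stalkMap_injective (f : M ⟶ N) [Mono f] (x : X) : Function.Injective (stalkMap f x) := by
  refine TopCat.Presheaf.stalkFunctor_map_injective_of_app_injective (f := f.mapPresheaf) ?_ x
  intro U
  have : Mono f.mapPresheaf := inferInstanceAs (Mono ((Scheme.Modules.toPresheaf X).map f))
  rw [← AddCommGrpCat.mono_iff_injective]
  infer_instance

/-! ### Modules that are locally generated by finitely many sections -/

/-- Every point has an open neighbourhood `U` with finitely many sections of `M` over `U` that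
generate all stalks of `M` at points of `U`. -/
def IsLocallyFG (M : X.Modules) : Prop :=
  ∀ x : X, ∃ (U : X.Opens) (_ : x ∈ U) (n : ℕ) (e : Fin n → Γ(M, U)),
    ∀ (y : X) (hy : y ∈ U), Submodule.span (X.presheaf.stalk y)
      (Set.range fun i ↦ M.presheaf.germ U y hy (e i)) = ⊤

lemma IsLocallyFG.of_epi (h : IsLocallyFG M) (f : M ⟶ N) [Epi f] : IsLocallyFG N := by
  intro x
  obtain ⟨U, hx, n, e, he⟩ := h x
  refine ⟨U, hx, n, fun i ↦ f.app U (e i), fun y hy ↦ ?_⟩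
  have := congrArg (Submodule.map (stalkMap f y)) (he y hy)
  rw [Submodule.map_top, LinearMap.range_eq_top.2 (stalkMap_surjective f y),
    Submodule.map_span, ← Set.range_comp] at this
  rw [← this]
  congr! 3 with i
  exact (stalkMap_germ f y U hy (e i)).symm

lemma IsLocallyFG.finite_stalk (h : IsLocallyFG M) (x : X) :
    Module.Finite (X.presheaf.stalk x) (M.presheaf.stalk x) := by
  obtain ⟨U, hx, n, e, he⟩ := h x
  exact ⟨Submodule.fg_def.2 ⟨_, Set.finite_range _, he x hx⟩⟩

lemma germ_mem_span {U : X.Opens} {ι : Type*} (v : ι → Γ(M, U)) {t : Γ(M, U)}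
    (ht : t ∈ Submodule.span Γ(X, U) (Set.range v)) (y : X) (hy : y ∈ U) :
    M.presheaf.germ U y hy t ∈ Submodule.span (X.presheaf.stalk y)
      (Set.range fun i ↦ M.presheaf.germ U y hy (v i)) := by
  induction ht using Submodule.span_induction with
  | mem _ h =>
    obtain ⟨i, rfl⟩ := h
    exact Submodule.subset_span ⟨i, rfl⟩
  | zero => rw [map_zero]; exact Submodule.zero_mem _
  | add a b _ _ ha hb => rw [map_add]; exact Submodule.add_mem _ ha hb
  | smul r a _ ha => rw [germ_smul]; exact Submodule.smul_mem _ _ ha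

lemma isLocallyFG_of_isFiniteType (M : X.Modules) (h : SheafOfModules.IsFiniteType (R := X.ringCatSheaf) M) :
    IsLocallyFG M := by
  intro x
  obtain ⟨S, hS, h⟩ := SheafOfModules.IsFiniteType.exists_sieve (R := X.ringCatSheaf) M ⊤
  obtain ⟨U, i, hi, hxU⟩ := hS x trivial
  obtain ⟨n, e, he⟩ := h i hi
  refine ⟨U, hxU, n, e, fun y hy ↦ ?_⟩
  rw [eq_top_iff]
  rintro m -
  obtain ⟨W, hyW, m, rfl⟩ := M.presheaf.exists_germ_eq m
  obtain ⟨T, hT, hT'⟩ := he (homOfLE (inf_le_right : W ⊓ U ≤ U))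
    (M.presheaf.map (homOfLE (inf_le_left : W ⊓ U ≤ W)).op m)
  obtain ⟨Z, r, hr, hyZ⟩ := hT y ⟨hyW, hy⟩
  have key : M.presheaf.map r.op (M.presheaf.map (homOfLE (inf_le_left : W ⊓ U ≤ W)).op m) ∈
      Submodule.span Γ(X, Z) (Set.range fun a ↦
        M.presheaf.map (r ≫ homOfLE (inf_le_right : W ⊓ U ≤ U)).op (e a)) := hT' r hr
  have := germ_mem_span _ key y hyZ
  rw [TopCat.Presheaf.germ_res_apply, TopCat.Presheaf.germ_res_apply] at this
  convert! this using 4 with a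
  exact (TopCat.Presheaf.germ_res_apply _ _ _ _ _).symm

/-! ### Bases of sections and bases of stalks -/

/-- Stated for a general value category because it serves both coefficients in `X.presheaf` and
generators in `M.presheaf`. -/
lemma exists_germ_family_eq {C : Type*} [Category.{u} C] [Limits.HasColimits C]
    {FC : C → C → Type*} {CC : C → Type u} [∀ X Y, FunLike (FC X Y) (CC X) (CC Y)]
    [ConcreteCategory C FC] [Limits.PreservesFilteredColimits (forget C)]
    {Y : TopCat.{u}} (F : TopCat.Presheaf C Y) {n : ℕ} {y : Y} (U : Opens Y) (hy : y ∈ U)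
    (a : Fin n → ToType (F.stalk y)) :
    ∃ (V : Opens Y) (_ : V ≤ U) (hV : y ∈ V) (b : Fin n → ToType (F.obj (.op V))),
      ∀ i, F.germ V y hV (b i) = a i := by
  choose W hW b hb using fun i ↦ F.exists_germ_eq (a i)
  have hV : y ∈ U ⊓ Finset.univ.inf W := ⟨hy, by simpa using hW⟩
  refine ⟨U ⊓ Finset.univ.inf W, inf_le_left, hV, fun i ↦
    F.map (homOfLE (inf_le_right.trans (Finset.inf_le (Finset.mem_univ i)))).op (b i),
    fun i ↦ ?_⟩
  rw [TopCat.Presheaf.germ_res_apply, hb]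

lemma exists_map_eq_of_germ_eq {U : X.Opens} {x : X} (hx : x ∈ U) {s t : Γ(M, U)}
    (h : M.presheaf.germ U x hx s = M.presheaf.germ U x hx t) :
    ∃ (V : X.Opens) (_ : x ∈ V) (hV : V ≤ U),
      M.presheaf.map (homOfLE hV).op s = M.presheaf.map (homOfLE hV).op t := by
  obtain ⟨V, hxV, i, j, h⟩ := TopCat.Presheaf.germ_eq _ x hx hx s t h
  exact ⟨V, hxV, i.le, h⟩

lemma map_map_apply {U V W : X.Opens} (h : W ≤ V) (h' : V ≤ U) (t : Γ(M, U)) :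
    M.presheaf.map (homOfLE h).op (M.presheaf.map (homOfLE h').op t) =
      M.presheaf.map (homOfLE (h.trans h')).op t := by
  rw [← ConcreteCategory.comp_apply, ← Functor.map_comp]
  rfl

lemma map_sum_smul {n : ℕ} {U V : X.Opens} (h : V ≤ U) (a : Fin n → Γ(X, U))
    (e : Fin n → Γ(M, U)) :
    M.presheaf.map (homOfLE h).op (∑ i, a i • e i) =
      ∑ i, X.presheaf.map (homOfLE h).op (a i) • M.presheaf.map (homOfLE h).op (e i) := by
  simp_rw [map_sum, Scheme.Modules.map_smul]

lemma germ_sum_smul {n : ℕ} {U : X.Opens} {x : X} (hx : x ∈ U) (a : Fin n → Γ(X, U))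
    (e : Fin n → Γ(M, U)) :
    M.presheaf.germ U x hx (∑ i, a i • e i) =
      ∑ i, X.presheaf.germ U x hx (a i) • M.presheaf.germ U x hx (e i) := by
  simp_rw [map_sum, germ_smul]

lemma IsBasisOn.mono {U V : X.Opens} {ι : Type} {e : ι → Γ(M, U)} (h : IsBasisOn M U e)
    (hVU : V ≤ U) : IsBasisOn M V (fun i ↦ M.presheaf.map (homOfLE hVU).op (e i)) := by
  intro W hW
  simp_rw [map_map_apply]
  exact h W (hW.trans hVU)

lemma IsBasisOn.span_germ {U : X.Opens} {ι : Type} {e : ι → Γ(M, U)} (h : IsBasisOn M U e)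
    (x : X) (hx : x ∈ U) : Submodule.span (X.presheaf.stalk x)
      (Set.range fun i ↦ M.presheaf.germ U x hx (e i)) = ⊤ := by
  rw [eq_top_iff]
  rintro m -
  obtain ⟨W, hxW, m, rfl⟩ := M.presheaf.exists_germ_eq m
  have h1 : M.presheaf.map (homOfLE (inf_le_left : W ⊓ U ≤ W)).op m ∈ _ :=
    (h (W ⊓ U) inf_le_right).2 ▸ Submodule.mem_top
  have hx' : x ∈ W ⊓ U := ⟨hxW, hx⟩
  have := germ_mem_span _ h1 x hx'
  simpa only [TopCat.Presheaf.germ_res_apply] using this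

/-- A relation between germs already holds over a small open set, where the restricted sections are
independent. -/
lemma IsBasisOn.linearIndependent_germ {U : X.Opens} {n : ℕ} {e : Fin n → Γ(M, U)}
    (h : IsBasisOn M U e) (x : X) (hx : x ∈ U) :
    LinearIndependent (X.presheaf.stalk x) (fun i ↦ M.presheaf.germ U x hx (e i)) := by
  rw [Fintype.linearIndependent_iff]
  intro a ha i
  obtain ⟨V, hVU, hxV, b, hb⟩ := exists_germ_family_eq X.presheaf U hx a
  have h1 : M.presheaf.germ V x hxV (∑ i, b i • M.presheaf.map (homOfLE hVU).op (e i)) =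
      M.presheaf.germ V x hxV 0 := by
    rw [germ_sum_smul, map_zero, ← ha]
    simp_rw [TopCat.Presheaf.germ_res_apply, hb]
  obtain ⟨W, hxW, hWV, h2⟩ := exists_map_eq_of_germ_eq hxV h1
  rw [map_sum_smul, map_zero] at h2
  simp_rw [map_map_apply] at h2
  have h3 := Fintype.linearIndependent_iff.1 (h W (hWV.trans hVU)).1 _ h2 i
  rw [← hb, ← TopCat.Presheaf.germ_res_apply X.presheaf (homOfLE hWV) x hxW, h3, map_zero]

/-- The basis of the stalk `M_x` given by a basis of sections of `M` near `x`. -/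
def IsBasisOn.stalkBasis {U : X.Opens} {n : ℕ} {e : Fin n → Γ(M, U)}
    (h : IsBasisOn M U e) (x : X) (hx : x ∈ U) :
    Module.Basis (Fin n) (X.presheaf.stalk x) (M.presheaf.stalk x) :=
  Module.Basis.mk (h.linearIndependent_germ x hx) (h.span_germ x hx).ge

/-- `M` is locally free of rank `n`. -/
def IsVectorBundle (M : X.Modules) (n : ℕ) : Prop :=
  ∀ x : X, ∃ (U : X.Opens) (_ : x ∈ U) (e : Fin n → Γ(M, U)), IsBasisOn M U e

lemma SuperModules.isSuperVectorBundle_iff (F : SuperModules X) (m n : ℕ) :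
    F.IsSuperVectorBundle m n ↔ IsVectorBundle F.even m ∧ IsVectorBundle F.odd n := by
  constructor
  · intro h
    refine ⟨fun x ↦ ?_, fun x ↦ ?_⟩
    · obtain ⟨U, hx, e, o, he, ho⟩ := h x
      exact ⟨U, hx, e, he⟩
    · obtain ⟨U, hx, e, o, he, ho⟩ := h x
      exact ⟨U, hx, o, ho⟩
  · rintro ⟨h, h'⟩ x
    obtain ⟨U, hx, e, he⟩ := h x
    obtain ⟨V, hx', o, ho⟩ := h' x
    exact ⟨U ⊓ V, ⟨hx, hx'⟩, _, _, he.mono inf_le_left, ho.mono inf_le_right⟩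

namespace IsVectorBundle

variable {n : ℕ}

lemma isLocallyFG (h : IsVectorBundle M n) : IsLocallyFG M := fun x ↦ by
  obtain ⟨U, hx, e, he⟩ := h x
  exact ⟨U, hx, n, e, he.span_germ⟩

lemma nonempty_stalkBasis (h : IsVectorBundle M n) (x : X) :
    Nonempty (Module.Basis (Fin n) (X.presheaf.stalk x) (M.presheaf.stalk x)) := by
  obtain ⟨U, hx, e, he⟩ := h x
  exact ⟨he.stalkBasis x hx⟩

lemma finrank_fibre (h : IsVectorBundle M n) (x : X) :
    Module.finrank (X.residueField x) (Fibre M x) = n := by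
  obtain ⟨b⟩ := h.nonempty_stalkBasis x
  rw [Module.finrank_eq_card_basis (b.baseChange (X.residueField x)), Fintype.card_fin]

end IsVectorBundle

/-! ### Constant fibre dimension on a reduced scheme -/

lemma linearIndependent_tmul_of_span_eq_top {n : ℕ} {x : X} (e : Fin n → M.presheaf.stalk x)
    (he : Submodule.span (X.presheaf.stalk x) (Set.range e) = ⊤)
    (hn : Module.finrank (X.residueField x) (Fibre M x) = n) :
    LinearIndependent (X.residueField x)
      (fun i ↦ ((1 : X.residueField x) ⊗ₜ[X.presheaf.stalk x] e i : Fibre M x)) := by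
  refine linearIndependent_of_top_le_span_of_card_eq_finrank ?_ (by simp [hn])
  have := Submodule.baseChange_span (R := X.presheaf.stalk x) (A := X.residueField x) (Set.range e)
  rw [he, Submodule.baseChange_top, ← Set.range_comp] at this
  exact this.le

lemma coeff_eq_zero_of_sum_smul_eq_zero [IsReduced X] {n : ℕ} {U : X.Opens} (e : Fin n → Γ(M, U))
    (he : ∀ (y : X) (hy : y ∈ U), LinearIndependent (X.residueField y) (fun i ↦
      ((1 : X.residueField y) ⊗ₜ[X.presheaf.stalk y] M.presheaf.germ U y hy (e i) : Fibre M y)))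
    (a : Fin n → Γ(X, U)) (h : ∑ i, a i • e i = 0) (i : Fin n) : a i = 0 := by
  -- Reducedness enters here: it suffices that `a i` is a unit in no stalk, and a unit would have
  -- nonzero residue, against independence in the fibre.
  rw [← basicOpen_eq_bot_iff, eq_bot_iff]
  intro y hy
  have hyU : y ∈ U := X.basicOpen_le _ hy
  rw [Scheme.mem_basicOpen _ _ _ hyU] at hy
  have h1 := congrArg (M.presheaf.germ U y hyU) h
  rw [germ_sum_smul, map_zero] at h1
  have h2 : ∑ i, X.residue y (X.presheaf.germ U y hyU (a i)) •
      ((1 : X.residueField y) ⊗ₜ[X.presheaf.stalk y] M.presheaf.germ U y hyU (e i) : Fibre M y) =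
      0 := by
    rw [← TensorProduct.tmul_zero (R := X.presheaf.stalk y) (M.presheaf.stalk y)
      (1 : X.residueField y), ← h1, TensorProduct.tmul_sum]
    refine Finset.sum_congr rfl fun i _ ↦ ?_
    rw [TensorProduct.tmul_smul, TensorProduct.smul_tmul', TensorProduct.smul_tmul',
      Algebra.smul_def]
    rfl
  have h3 := Fintype.linearIndependent_iff.1 (he y hyU) _ h2 i
  exact ((hy.map (X.residue y).hom).ne_zero h3).elim

/-- Independence holds over every smaller open set, so the coefficients expressing a section locally
are unique and therefore glue. -/
lemma isBasisOn_of_span_germ_eq_top [IsReduced X] {n : ℕ} {U : X.Opens} (e : Fin n → Γ(M, U))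
    (he : ∀ (y : X) (hy : y ∈ U), Submodule.span (X.presheaf.stalk y)
      (Set.range fun i ↦ M.presheaf.germ U y hy (e i)) = ⊤)
    (hn : ∀ y : X, Module.finrank (X.residueField y) (Fibre M y) = n) : IsBasisOn M U e := by
  have hli (V : X.Opens) (h : V ≤ U) (a : Fin n → Γ(X, V))
      (ha : ∑ i, a i • M.presheaf.map (homOfLE h).op (e i) = 0) (i : Fin n) : a i = 0 := by
    refine coeff_eq_zero_of_sum_smul_eq_zero _ (fun y hy ↦ ?_) a ha i
    simp_rw [TopCat.Presheaf.germ_res_apply]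
    exact linearIndependent_tmul_of_span_eq_top _ (he y (h hy)) (hn y)
  intro V h
  refine ⟨Fintype.linearIndependent_iff.2 (hli V h), ?_⟩
  rw [eq_top_iff]
  rintro t -
  have hloc (y : V) : ∃ (W : X.Opens) (_ : y.1 ∈ W) (hW : W ≤ V) (a : Fin n → Γ(X, W)),
      ∑ i, a i • M.presheaf.map (homOfLE (hW.trans h)).op (e i) =
        M.presheaf.map (homOfLE hW).op t := by
    have h1 : M.presheaf.germ V y y.2 t ∈ _ := he y (h y.2) ▸ Submodule.mem_top
    obtain ⟨c, hc⟩ := (Submodule.mem_span_range_iff_exists_fun _).1 h1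
    obtain ⟨W, hWV, hyW, a, ha⟩ := exists_germ_family_eq X.presheaf V y.2 c
    have h2 : M.presheaf.germ W y hyW
        (∑ i, a i • M.presheaf.map (homOfLE (hWV.trans h)).op (e i)) =
        M.presheaf.germ W y hyW (M.presheaf.map (homOfLE hWV).op t) := by
      rw [germ_sum_smul, TopCat.Presheaf.germ_res_apply, ← hc]
      simp_rw [TopCat.Presheaf.germ_res_apply, ha]
    obtain ⟨W', hyW', hW', h3⟩ := exists_map_eq_of_germ_eq hyW h2
    refine ⟨W', hyW', hW'.trans hWV, fun i ↦ X.presheaf.map (homOfLE hW').op (a i), ?_⟩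
    rw [map_sum_smul] at h3
    simp_rw [map_map_apply] at h3
    exact h3
  choose W hyW hWV a ha using hloc
  have hcover : V ≤ iSup W := fun y hy ↦ Opens.mem_iSup.2 ⟨⟨y, hy⟩, hyW ⟨y, hy⟩⟩
  have hcomp (i : Fin n) : TopCat.Presheaf.IsCompatible X.sheaf.obj W (fun y ↦ a y i) := by
    intro y z
    have h1 : ∑ i, (X.presheaf.map (homOfLE (inf_le_left : W y ⊓ W z ≤ W y)).op (a y i) -
        X.presheaf.map (homOfLE (inf_le_right : W y ⊓ W z ≤ W z)).op (a z i)) •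
        M.presheaf.map (homOfLE
          (((inf_le_left : W y ⊓ W z ≤ W y).trans (hWV y)).trans h)).op (e i) = 0 := by
      have hy := congrArg (M.presheaf.map (homOfLE (inf_le_left : W y ⊓ W z ≤ W y)).op) (ha y)
      have hz := congrArg (M.presheaf.map (homOfLE (inf_le_right : W y ⊓ W z ≤ W z)).op) (ha z)
      rw [map_sum_smul] at hy hz
      simp_rw [map_map_apply] at hy hz
      simp_rw [sub_smul, Finset.sum_sub_distrib]
      rw [hy, hz, sub_self]
    exact sub_eq_zero.1 (hli _ _ _ h1 i)
  choose b hb using fun i ↦ (X.sheaf.existsUnique_gluing' W V (fun y ↦ homOfLE (hWV y)) hcover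
    (fun y ↦ a y i) (hcomp i)).exists
  refine (Submodule.mem_span_range_iff_exists_fun _).2 ⟨b, ?_⟩
  refine TopCat.Sheaf.eq_of_locally_eq' ⟨M.presheaf, M.isSheaf⟩ W V (fun y ↦ homOfLE (hWV y))
    hcover _ _ fun y ↦ ?_
  refine (map_sum_smul (hWV y) _ _).trans (Eq.trans ?_ (ha y))
  refine Finset.sum_congr rfl fun i _ ↦ ?_
  rw [map_map_apply]
  congr 1
  exact hb i y

lemma exists_span_eq_top_of_finrank_fibre (x : X)
    [Module.Finite (X.presheaf.stalk x) (M.presheaf.stalk x)] {n : ℕ}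
    (hn : Module.finrank (X.residueField x) (Fibre M x) = n) :
    ∃ f : Fin n → M.presheaf.stalk x,
      Submodule.span (X.presheaf.stalk x) (Set.range f) = ⊤ := by
  have hs : ⊤ ≤ Submodule.span (X.residueField x)
      (Set.range fun m : M.presheaf.stalk x ↦
        ((1 : X.residueField x) ⊗ₜ[X.presheaf.stalk x] m : Fibre M x)) := by
    have := Submodule.baseChange_span (R := X.presheaf.stalk x) (A := X.residueField x)
      (Set.univ : Set (M.presheaf.stalk x))
    rw [Submodule.span_univ, Submodule.baseChange_top, Set.image_univ] at this
    exact this.le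
  -- Extracting the basis from the tensors `1 ⊗ₜ m` makes each basis vector liftable to the stalk,
  -- as Nakayama requires.
  let b := Module.Basis.ofSpan hs
  have hb := Module.Basis.ofSpan_subset hs
  have := Module.Finite.finite_basis b
  have := Fintype.ofFinite
  let b' := b.reindex (Fintype.equivFinOfCardEq ((Module.finrank_eq_card_basis b).symm.trans hn))
  have hf (i : Fin n) : ∃ m : M.presheaf.stalk x, 1 ⊗ₜ m = b' i := by
    refine hb ?_
    rw [Module.Basis.reindex_apply]
    exact Set.mem_range_self _
  choose f hf using hf
  exact ⟨f, IsLocalRing.span_eq_top_of_tmul_eq_basis f b' hf⟩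

theorem isVectorBundle_of_finrank_fibre [IsReduced X] {n : ℕ} (h : IsLocallyFG M)
    (hn : ∀ y : X, Module.finrank (X.residueField y) (Fibre M y) = n) : IsVectorBundle M n := by
  intro x
  have := h.finite_stalk x
  obtain ⟨f, hf⟩ := exists_span_eq_top_of_finrank_fibre x (hn x)
  obtain ⟨U, hxU, r, e, he⟩ := h x
  obtain ⟨V, hVU, hxV, g, hg⟩ := exists_germ_family_eq M.presheaf U hxU f
  -- Near `x` each of the finitely many old generators `e j` is a combination of the lifts `g i`, so
  -- the lifts generate all nearby stalks.
  have hloc (j : Fin r) : ∃ (W : X.Opens) (_ : x ∈ W) (hW : W ≤ V),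
      M.presheaf.map (homOfLE (hW.trans hVU)).op (e j) ∈ Submodule.span Γ(X, W)
        (Set.range fun i ↦ M.presheaf.map (homOfLE hW).op (g i)) := by
    have h1 : M.presheaf.germ U x hxU (e j) ∈ _ := hf ▸ Submodule.mem_top
    obtain ⟨c, hc⟩ := (Submodule.mem_span_range_iff_exists_fun _).1 h1
    obtain ⟨W, hWV, hxW, a, ha⟩ := exists_germ_family_eq X.presheaf V hxV c
    have h2 : M.presheaf.germ W x hxW (∑ i, a i • M.presheaf.map (homOfLE hWV).op (g i)) =
        M.presheaf.germ W x hxW (M.presheaf.map (homOfLE (hWV.trans hVU)).op (e j)) := by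
      rw [germ_sum_smul, TopCat.Presheaf.germ_res_apply, ← hc]
      simp_rw [TopCat.Presheaf.germ_res_apply, ha, hg]
    obtain ⟨W', hxW', hW', h3⟩ := exists_map_eq_of_germ_eq hxW h2
    refine ⟨W', hxW', hW'.trans hWV, (Submodule.mem_span_range_iff_exists_fun _).2
      ⟨fun i ↦ X.presheaf.map (homOfLE hW').op (a i), ?_⟩⟩
    rw [map_sum_smul] at h3
    simp_rw [map_map_apply] at h3
    exact h3
  choose W hxW hWV hW using hloc
  have hx' : x ∈ V ⊓ Finset.univ.inf W := ⟨hxV, by simpa using hxW⟩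
  refine ⟨V ⊓ Finset.univ.inf W, hx', fun i ↦ M.presheaf.map (homOfLE inf_le_left).op (g i),
    isBasisOn_of_span_germ_eq_top _ (fun y hy ↦ ?_) hn⟩
  have hyV : y ∈ V := hy.1
  rw [eq_top_iff, ← he y (hVU hyV), Submodule.span_le]
  rintro _ ⟨j, rfl⟩
  have hyW : y ∈ W j := (inf_le_right.trans (Finset.inf_le (Finset.mem_univ j)) :
    V ⊓ Finset.univ.inf W ≤ W j) hy
  have := germ_mem_span _ (hW j) y hyW
  simp_rw [TopCat.Presheaf.germ_res_apply] at this ⊢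
  exact this

/-! ### Fibres of kernels, images and cokernels -/

lemma fibreMap_surjective (f : M ⟶ N) [Epi f] (x : X) : Function.Surjective (fibreMap f x) :=
  LinearMap.lTensor_surjective (X.residueField x) (stalkMap_surjective f x)

lemma fibreMap_exact (f : M ⟶ N) (x : X) :
    Function.Exact (fibreMap f x) (fibreMap (Limits.cokernel.π f) x) :=
  lTensor_exact (X.residueField x) (stalkMap_exact f x) (stalkMap_surjective _ x)

/-- The dimension of the fibre of a cokernel. -/
lemma finrank_fibre_cokernel (f : M ⟶ N) (x : X)
    [Module.Finite (X.residueField x) (Fibre N x)] :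
    Module.finrank (X.residueField x) (LinearMap.range (fibreMap f x)) +
        Module.finrank (X.residueField x) (Fibre (Limits.cokernel f) x) =
      Module.finrank (X.residueField x) (Fibre N x) := by
  have h := LinearMap.finrank_range_add_finrank_ker (fibreMap (Limits.cokernel.π f) x)
  rw [LinearMap.exact_iff.1 (fibreMap_exact f x),
    LinearMap.range_eq_top.2 (fibreMap_surjective (Limits.cokernel.π f) x), finrank_top] at h
  omega

/-- The map onto the image is surjective on stalks, so `f` and the inclusion of its image have the
same range there. -/
lemma stalkMap_image_ι_exact (f : M ⟶ N) (x : X) :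
    Function.Exact (stalkMap (Abelian.image.ι f) x) (stalkMap (Limits.cokernel.π f) x) := by
  intro n
  rw [stalkMap_exact f x n]
  constructor
  · rintro ⟨m, rfl⟩
    refine ⟨stalkMap (Abelian.factorThruImage f) x m, ?_⟩
    rw [← stalkMap_comp_apply, Abelian.image.fac]
  · rintro ⟨i, rfl⟩
    obtain ⟨m, rfl⟩ := stalkMap_surjective (Abelian.factorThruImage f) x i
    refine ⟨m, ?_⟩
    rw [← stalkMap_comp_apply, Abelian.image.fac]

/-- If the cokernel of `f` is locally free, the fibres of the image of `f` are the images of the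
maps that `f` induces on fibres. -/
lemma finrank_fibre_image (f : M ⟶ N) (x : X)
    [Module.Finite (X.residueField x) (Fibre N x)]
    [Module.Free (X.presheaf.stalk x) ((Limits.cokernel f).presheaf.stalk x)] :
    Module.finrank (X.residueField x) (Fibre (Abelian.image f) x) =
      Module.finrank (X.residueField x) (LinearMap.range (fibreMap f x)) := by
  have hex := stalkMap_image_ι_exact f x
  have hinj := stalkMap_injective (Abelian.image.ι f) x
  have hsurj := stalkMap_surjective (Limits.cokernel.π f) x
  -- A free cokernel stalk splits the sequence; the retraction `l` survives base change and keeps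
  -- the inclusion of the image injective on fibres.
  obtain ⟨s, hs⟩ := Module.projective_lifting_property
    (stalkMap (Limits.cokernel.π f) x) LinearMap.id hsurj
  have htfae := Function.Exact.split_tfae hex hinj hsurj
  obtain ⟨l, hl⟩ := (htfae.out 0 1 rfl rfl).1 ⟨s, hs⟩
  have hinj' : Function.Injective (fibreMap (Abelian.image.ι f) x) := by
    have : (l.baseChange (X.residueField x)) ∘ₗ (fibreMap (Abelian.image.ι f) x) =
        LinearMap.id := by
      rw [fibreMap, ← LinearMap.baseChange_comp, hl, LinearMap.baseChange_id]
    exact Function.LeftInverse.injective (g := l.baseChange (X.residueField x))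
      fun v ↦ LinearMap.congr_fun this v
  have hex' : Function.Exact (fibreMap (Abelian.image.ι f) x)
      (fibreMap (Limits.cokernel.π f) x) := lTensor_exact (X.residueField x) hex hsurj
  rw [← LinearMap.finrank_range_of_inj hinj', ← LinearMap.exact_iff.1 hex',
    LinearMap.exact_iff.1 (fibreMap_exact f x)]

lemma finrank_fibre_eq_of_isIso (f : M ⟶ N) [IsIso f] (x : X) :
    Module.finrank (X.residueField x) (Fibre M x) =
      Module.finrank (X.residueField x) (Fibre N x) :=
  let e := LinearEquiv.ofBijective (stalkMap f x) ⟨stalkMap_injective f x, stalkMap_surjective f x⟩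
  (e.baseChange (X.presheaf.stalk x) (X.residueField x) _ _).finrank_eq

namespace IsVectorBundle

variable {m n r : ℕ}

lemma finite_fibre (h : IsVectorBundle M n) (x : X) :
    Module.Finite (X.residueField x) (Fibre M x) :=
  have := h.isLocallyFG.finite_stalk x
  inferInstance

lemma finrank_range_add_finrank_cokernel (hN : IsVectorBundle N n) (f : M ⟶ N) (x : X) :
    Module.finrank (X.residueField x) (LinearMap.range (fibreMap f x)) +
        Module.finrank (X.residueField x) (Fibre (Limits.cokernel f) x) = n := by
  have := hN.finite_fibre x
  rw [finrank_fibre_cokernel, hN.finrank_fibre]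

/-- The bound `c ≤ n` makes the truncated `n - c` a true difference; it is read off at any point,
hence `Nonempty X`. -/
lemma cokernel_iff [IsReduced X] [Nonempty X] (hN : IsVectorBundle N n) (f : M ⟶ N) (c : ℕ) :
    IsVectorBundle (Limits.cokernel f) c ↔ c ≤ n ∧ ∀ x : X,
      Module.finrank (X.residueField x) (LinearMap.range (fibreMap f x)) = n - c := by
  constructor
  · intro h
    have key (x : X) := h.finrank_fibre x ▸ hN.finrank_range_add_finrank_cokernel f x
    exact ⟨by have := key (Classical.arbitrary X); omega, fun x ↦ by have := key x; omega⟩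
  · rintro ⟨hc, h⟩
    refine isVectorBundle_of_finrank_fibre (hN.isLocallyFG.of_epi (Limits.cokernel.π f)) fun x ↦ ?_
    have := hN.finrank_range_add_finrank_cokernel f x
    have := h x
    omega

lemma cokernel_sub_iff [IsReduced X] [Nonempty X] (hN : IsVectorBundle N n) (f : M ⟶ N) :
    (r ≤ n ∧ IsVectorBundle (Limits.cokernel f) (n - r)) ↔
      ∀ x : X, Module.finrank (X.residueField x) (LinearMap.range (fibreMap f x)) = r := by
  rw [hN.cokernel_iff]
  constructor
  · rintro ⟨hr, -, h⟩ x
    rw [h x]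
    omega
  · intro h
    have hr : r ≤ n := by
      have := hN.finrank_range_add_finrank_cokernel f (Classical.arbitrary X)
      have := h (Classical.arbitrary X)
      omega
    exact ⟨hr, by omega, fun x ↦ by rw [h x]; omega⟩

lemma image [IsReduced X] [Nonempty X] (hM : IsVectorBundle M m) (hN : IsVectorBundle N n)
    (f : M ⟶ N)
    (h : ∀ x : X, Module.finrank (X.residueField x) (LinearMap.range (fibreMap f x)) = r) :
    IsVectorBundle (Abelian.image f) r := by
  refine isVectorBundle_of_finrank_fibre
    (hM.isLocallyFG.of_epi (Abelian.factorThruImage f)) fun x ↦ ?_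
  have := hN.finite_fibre x
  obtain ⟨b⟩ := ((hN.cokernel_sub_iff f).2 h).2.nonempty_stalkBasis x
  have := Module.Free.of_basis b
  rw [finrank_fibre_image, h]

lemma coimage [IsReduced X] [Nonempty X] (hM : IsVectorBundle M m) (hN : IsVectorBundle N n)
    (f : M ⟶ N)
    (h : ∀ x : X, Module.finrank (X.residueField x) (LinearMap.range (fibreMap f x)) = r) :
    IsVectorBundle (Abelian.coimage f) r := by
  refine isVectorBundle_of_finrank_fibre
    (hM.isLocallyFG.of_epi (Abelian.coimage.π f)) fun x ↦ ?_
  rw [finrank_fibre_eq_of_isIso (Abelian.coimageImageComparison f),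
    (hM.image hN f h).finrank_fibre]

end IsVectorBundle

/-! ### Projective space -/

/-- Each stalk is a homogeneous localization, which embeds in a localization of the polynomial
domain. -/
instance isReduced_projectiveSpace (k : Type u) [Field k] (s : ℕ) :
    IsReduced (ProjectiveSpace k s) := by
  let _ := MvPolynomial.gradedAlgebra (σ := Fin s) (R := k)
  let 𝒜 := MvPolynomial.homogeneousSubmodule (Fin s) k
  have (x : Proj 𝒜) : _root_.IsReduced ((Proj 𝒜).presheaf.stalk x) := by
    have := ProjectiveSpectrum.isPrime x
    have : IsDomain (Localization.AtPrime x.asHomogeneousIdeal.toIdeal) :=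
      IsLocalization.isDomain_localization x.asHomogeneousIdeal.toIdeal.primeCompl_le_nonZeroDivisors
    have : _root_.IsReduced (HomogeneousLocalization.AtPrime 𝒜 x.asHomogeneousIdeal.toIdeal) :=
      isReduced_of_injective (algebraMap _ (Localization.AtPrime x.asHomogeneousIdeal.toIdeal))
        (HomogeneousLocalization.val_injective _)
    exact isReduced_of_injective _ (Proj.stalkIso 𝒜 x).commRingCatIsoToRingEquiv.injective
  exact isReduced_of_isReduced_stalk (Proj 𝒜)

/-- The chart where the first variable is invertible is the spectrum of a nontrivial ring. -/
lemma nonempty_projectiveSpace (k : Type u) [Field k] (s : ℕ) (hs : 1 ≤ s) :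
    Nonempty (ProjectiveSpace k s) := by
  let _ := MvPolynomial.gradedAlgebra (σ := Fin s) (R := k)
  let 𝒜 := MvPolynomial.homogeneousSubmodule (Fin s) k
  let t : MvPolynomial (Fin s) k := MvPolynomial.X ⟨0, hs⟩
  have ht : t ∈ 𝒜 1 := MvPolynomial.isHomogeneous_X k _
  have : IsDomain (Localization.Away t) := IsLocalization.isDomain_localization
    (powers_le_nonZeroDivisors_of_noZeroDivisors (MvPolynomial.X_ne_zero _))
  have : Nontrivial (HomogeneousLocalization.Away 𝒜 t) :=
    (algebraMap (HomogeneousLocalization.Away 𝒜 t) (Localization.Away t)).domain_nontrivial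
  have : Nonempty (Spec (.of (HomogeneousLocalization.Away 𝒜 t))) := inferInstance
  exact this.map (Proj.awayι 𝒜 t ht one_pos)

end SuperGeometry

end

theorem mainTheorem4 (k : Type u) [Field k] [IsAlgClosed k] [CharZero k] (s : ℕ) (hs : 1 ≤ s) :
    (∀ F : SuperGeometry.SuperModules (SuperGeometry.ProjectiveSpace k s), F.IsCoherent →
      ∀ rEv rOd : ℕ,
        F.IsSuperVectorBundle rEv rOd ↔
          ∀ x : SuperGeometry.ProjectiveSpace k s, F.fibreDim x = (rEv, rOd)) ∧
    (∀ (F F' : SuperGeometry.SuperModules (SuperGeometry.ProjectiveSpace k s))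
      (f : SuperGeometry.OddHom F F') (m n rEv rOd : ℕ),
      F.IsSuperVectorBundle m n → F'.IsSuperVectorBundle rEv rOd →
      (∀ rEv' rOd' : ℕ,
        ((rOd' ≤ rEv ∧ rEv' ≤ rOd ∧
            f.coker.IsSuperVectorBundle (rEv - rOd') (rOd - rEv')) ↔
          ∀ x : SuperGeometry.ProjectiveSpace k s, f.fibreRank x = (rEv', rOd')) ∧
        ((∀ x : SuperGeometry.ProjectiveSpace k s, f.fibreRank x = (rEv', rOd')) →
          f.image.IsSuperVectorBundle rOd' rEv' ∧
          f.coimage.IsSuperVectorBundle rEv' rOd')) ∧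
      ((∃ cEv cOd : ℕ, f.coker.IsSuperVectorBundle cEv cOd) ↔
        ∃ rEv' rOd' : ℕ, ∀ x : SuperGeometry.ProjectiveSpace k s,
          f.fibreRank x = (rEv', rOd'))) := by
  have := SuperGeometry.nonempty_projectiveSpace k s hs
  refine ⟨fun F hF rEv rOd ↦ ?_, fun F F' f m n rEv rOd hF hF' ↦ ?_⟩
  · have hfg := SuperGeometry.isLocallyFG_of_isFiniteType F.total hF.2
    -- Both homogeneous parts are quotients of the coherent total module.
    have hev : SuperGeometry.IsLocallyFG F.even :=
      SuperGeometry.IsLocallyFG.of_epi (M := F.even ⊞ F.odd) hfg Limits.biprod.fst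
    have hod : SuperGeometry.IsLocallyFG F.odd :=
      SuperGeometry.IsLocallyFG.of_epi (M := F.even ⊞ F.odd) hfg Limits.biprod.snd
    simp only [SuperGeometry.SuperModules.isSuperVectorBundle_iff,
      SuperGeometry.SuperModules.fibreDim, Prod.mk.injEq]
    exact ⟨fun h x ↦ ⟨h.1.finrank_fibre x, h.2.finrank_fibre x⟩, fun h ↦
      ⟨SuperGeometry.isVectorBundle_of_finrank_fibre hev fun x ↦ (h x).1,
        SuperGeometry.isVectorBundle_of_finrank_fibre hod fun x ↦ (h x).2⟩⟩
  · simp only [SuperGeometry.SuperModules.isSuperVectorBundle_iff,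
      SuperGeometry.OddHom.fibreRank, Prod.mk.injEq, SuperGeometry.OddHom.coker,
      SuperGeometry.OddHom.image, SuperGeometry.OddHom.coimage] at hF hF' ⊢
    refine ⟨fun rEv' rOd' ↦ ⟨?_, fun h ↦ ⟨⟨?_, ?_⟩, ?_, ?_⟩⟩, ?_⟩
    -- Parities cross: the even part of the cokernel is governed by `oddToEven`, of rank `rOd'`, and
    -- the odd part by `evenToOdd`, of rank `rEv'`.
    · rw [forall_and, ← hF'.1.cokernel_sub_iff f.oddToEven, ← hF'.2.cokernel_sub_iff f.evenToOdd]
      tauto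
    · exact hF.2.image hF'.1 _ fun x ↦ (h x).2
    · exact hF.1.image hF'.2 _ fun x ↦ (h x).1
    · exact hF.1.coimage hF'.2 _ fun x ↦ (h x).1
    · exact hF.2.coimage hF'.1 _ fun x ↦ (h x).2
    · constructor
      · rintro ⟨cEv, cOd, hEv, hOd⟩
        exact ⟨_, _, fun x ↦
          ⟨((hF'.2.cokernel_iff _ _).1 hOd).2 x, ((hF'.1.cokernel_iff _ _).1 hEv).2 x⟩⟩
      · rintro ⟨rEv', rOd', h⟩
        exact ⟨_, _, ((hF'.1.cokernel_sub_iff _).2 fun x ↦ (h x).2).2,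
          ((hF'.2.cokernel_sub_iff _).2 fun x ↦ (h x).1).2⟩
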